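/- For every integer $k\ge 1$ let $G_k$ be the simple undirected graph with $2k+6$ vertices consisting of: the path $1 - 2 - 3 - 5 - 6 - 7$; a $(k+1)$-clique formed by vertex $3$ and $k$ further vertices (all labeled $4$); and a $(k+1)$-clique formed by the vertices $0$, $7$ and $k-1$ further vertices (all labeled $8$). Let $G_k'$ be the graph obtained from $G_k$ by adding the edge $0 - 1$. For a graph $G$ with $n$ vertices, none of them isolated, PageRank with damping factor $\alpha$ (and uniform preference vector) is the row vector $(1-\alpha)\,\tfrac1n\mathbf 1\,(1-\alpha\bar G)^{-1}$, where $\bar G$ is the row-normalized adjacency matrix of $G$. A centrality $c$ is rank monotone on $G$ if, for all pairs of distinct non-adjacent vertices $x,y$ and every vertex $z\ne x,y$, writing $G'$ for $G$ with the edge $x - y$ added, for each endpoint $w\in\{x,y\}$ the inequality $c_G(z)<c_G(w)$ implies $c_{G'}(z)<c_{G'}(w)$, and $c_G(z)\le c_G(w)$ implies $c_{G'}(z)\le c_{G'}(w)$. Theorem. For every $\alpha\in(0,1)$ there is a $k_0\geq 1$ such that for all $k\ge k_0$ PageRank $c$ with damping factor $\alpha$ is not rank monotone on $G_k$. More precisely,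 $0$ and $1$ are not adjacent in $G_k$, and: (i) $c_{G_k}(1)<c_{G_k}(0)$, that is, $1$ is the less important endpoint of the new edge (bottom violation); (ii) $c_{G_k}(5)<c_{G_k}(1)$ but $c_{G_k'}(1)<c_{G_k'}(5)$, that is, vertex $1$ is overtaken by vertex $5$; (iii) vertex $1$ is demoted: the number of vertices with a score larger than that of vertex $1$ is larger in $G_k'$ than in $G_k$. -/

import Mathlib

noncomputable section

/-- A centrality on the (simple, undirected) graphs with vertex set `V`: it assigns a real score
to every vertex of every graph. -/
abbrev Centrality (V : Type*) := SimpleGraph V → V → ℝ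

/-- The graph `G` with the additional edge `x — y`. -/
def addEdge {V : Type*} (G : SimpleGraph V) (x y : V) : SimpleGraph V :=
  G ⊔ SimpleGraph.edge x y

/-- `c` is rank monotone on `G`: whenever a new edge `x — y` is added, every vertex `z` that was
dominated (strictly or weakly) by `x` or by `y` remains so. -/
def IsRankMonotoneOn {V : Type*} (c : Centrality V) (G : SimpleGraph V) : Prop :=
  ∀ x y : V, x ≠ y → ¬ G.Adj x y → ∀ z : V, z ≠ x → z ≠ y →
    (c G z < c G x → c (addEdge G x y) z < c (addEdge G x y) x) ∧
    (c G z < c G y → c (addEdge G x y) z < c (addEdge G x y) y) ∧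
    (c G z ≤ c G x → c (addEdge G x y) z ≤ c (addEdge G x y) x) ∧
    (c G z ≤ c G y → c (addEdge G x y) z ≤ c (addEdge G x y) y)

/-- The vertex `w` is demoted when passing from `G` to `G'`: the number of vertices with a larger
score than `w` increases. -/
def IsDemoted {V : Type*} (c : Centrality V) (G G' : SimpleGraph V) (w : V) : Prop :=
  {z : V | c G w < c G z}.ncard < {z : V | c G' w < c G' z}.ncard

open Classical in
/-- The row-normalized adjacency matrix (null rows are left untouched). -/
def rowNormalizedAdj {V : Type*} [Fintype V] (G : SimpleGraph V) : Matrix V V ℝ :=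
  Matrix.of fun x y => if G.Adj x y then 1 / (G.degree x : ℝ) else 0

open Classical in
/-- PageRank with damping factor `α` and preference (row) vector `v` of a graph without isolated
vertices: `(1 - α) v (1 - α Ḡ)⁻¹`, where `Ḡ` is the row-normalized adjacency matrix. -/
def pageRank {V : Type*} [Fintype V] (α : ℝ) (v : V → ℝ) : Centrality V := fun G =>
  (1 - α) • Matrix.vecMul v (1 - α • rowNormalizedAdj G)⁻¹

/-- The uniform preference vector. -/
def uniformPreference (V : Type*) [Fintype V] : V → ℝ := fun _ => 1 / (Fintype.card V : ℝ)

open Classical in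
/-- The inverse in the definition of PageRank is a genuine one. -/
theorem isUnit_one_sub_smul_rowNormalizedAdj {V : Type*} [Fintype V] {α : ℝ} (h0 : 0 ≤ α)
    (h1 : α < 1) (G : SimpleGraph V) : IsUnit (1 - α • rowNormalizedAdj G) := by
  rw [Matrix.isUnit_iff_isUnit_det, isUnit_iff_ne_zero]
  apply det_ne_zero_of_sum_row_lt_diag
  intro x
  have hx : (1 - α • rowNormalizedAdj G) x x = 1 := by simp [rowNormalizedAdj]
  have hy : ∀ y ∈ Finset.univ.erase x, ‖(1 - α • rowNormalizedAdj G) x y‖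
      = α * (if G.Adj x y then 1 / (G.degree x : ℝ) else 0) := by
    intro y hy
    have hne : x ≠ y := fun h => by simp [h] at hy
    simp only [Matrix.sub_apply, Matrix.one_apply_ne hne, Matrix.smul_apply, rowNormalizedAdj,
      Matrix.of_apply, smul_eq_mul, zero_sub, norm_neg]
    rw [Real.norm_of_nonneg]
    split_ifs <;> positivity
  have hs : ∑ y, (if G.Adj x y then 1 / (G.degree x : ℝ) else 0) ≤ 1 := by
    rw [← Finset.sum_filter, Finset.sum_const, ← SimpleGraph.neighborFinset_eq_filter,
      SimpleGraph.card_neighborFinset_eq_degree, nsmul_eq_mul, mul_one_div]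
    exact div_self_le_one _
  rw [hx, Finset.sum_congr rfl hy, ← Finset.mul_sum, Finset.sum_erase _ (by simp), norm_one]
  nlinarith

/-- Number of vertices of `G_k` with a given label: `k` vertices have label `4`, `k - 1` vertices
have label `8`, and every other label belongs to exactly one vertex. -/
def prMult (k : ℕ) : Fin 9 → ℕ := ![1, 1, 1, 1, k, 1, 1, 1, k - 1]

/-- The vertices of `G_k`: pairs of a label in `{0, …, 8}` and an index. -/
abbrev PRVertex (k : ℕ) := (l : Fin 9) × Fin (prMult k l)

/-- The pairs of labels between which `G_k` has edges. -/
def prLabelEdges : Finset (Fin 9 × Fin 9) :=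
  {(0, 7), (0, 8), (7, 8), (8, 8), (7, 6), (6, 5), (5, 3), (3, 4), (4, 4), (3, 2), (2, 1)}

/-- The graph `G_k` (for `k ≥ 1`): the vertices labelled `4` form a `(k+1)`-clique with `3`, the
vertices labelled `8` form a `(k+1)`-clique with `0` and `7`, and there are further the edges of
the path `1 — 2 — 3 — 5 — 6 — 7`. -/
def prGraph (k : ℕ) : SimpleGraph (PRVertex k) :=
  SimpleGraph.fromRel fun x y => (x.1, y.1) ∈ prLabelEdges

/-- The vertex `0` of `G_k`. -/
def prV0 (k : ℕ) : PRVertex k := ⟨0, ⟨0, Nat.one_pos⟩⟩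

/-- The vertex `1` of `G_k`. -/
def prV1 (k : ℕ) : PRVertex k := ⟨1, ⟨0, Nat.one_pos⟩⟩

/-- The vertex `5` of `G_k`. -/
def prV5 (k : ℕ) : PRVertex k := ⟨5, ⟨0, Nat.one_pos⟩⟩

end

/-!
Up to the positive factor `(1 - α) / n`, which does not affect comparisons, PageRank is the solution
`s` of `s x = 1 + α * ∑ s y / deg y`, the sum being over the neighbours `y` of `x`
(`pageRankSeries_eq`). Vertices of `G_k` with the same label are twins and have the same score, so
for both `G_k` and `G_k'` the system collapses to nine equations (`exists_labelScore`,
`IsPRScore`). By a maximum principle `s x / deg x ≤ 1 / (1 - α)` in absolute value, and feeding this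
bound back into the equations shows that the scores of `0`, `3` and `7` stay bounded as `k` grows
(`IsPRScore.abs_le`), while their degrees do not. Hence what a single neighbour receives from one of
them vanishes in the limit, and all limits are explicit (`PRLimits.of_isPRScore`).

In `G_k` the limit of `s 1` is `(1 + α / 2) / (1 - α ^ 2 / 2)`. It lies strictly between
`1 / (1 - α / 2)`, the limit for `5` and `6`, and `1 / (1 - α)`, the limit for `0`
(`eventually_prGraph_lt`). The new edge makes `2 — 1` and `5 — 6` look alike: both become pairs of
adjacent vertices of degree two between two large cliques, and `s 1`, `s 2`, `s 5`, `s 6` all tend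
to `r = 1 / (1 - α / 2)`. The order of `1`, `2` and `5` is decided by the terms of order `1 / k`:

* `(1 + α / 2) (s 2 - s 1) = α (q 3 - q 0)`,
* `(1 - α ^ 2 / 4) (s 5 - s 1) = α (q 3 - q 0) + α ^ 2 / 2 * (q 7 - q 3)`,

where `q i = s i / deg i`. Multiplied by `k + 1`, the differences `q 3 - q 0` and `q 7 - q 3` tend
to `α r / 2` and `- α r / 2`, so both right-hand sides are eventually positive
(`eventually_addEdge_prGraph_lt`). Thus in `G_k'` every vertex other than `1` and
possibly `6` is above `1`, whereas in `G_k` neither `5` nor `6` is: `1` is overtaken by `5` and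
demoted.
-/

/-! ### The linear system satisfied by PageRank -/

open Classical in
/-- PageRank up to the positive factor `(1 - α) / n`: the solution `s` of `s = 𝟏 + α s Ḡ`. -/
noncomputable def pageRankSeries {V : Type*} [Fintype V] (α : ℝ) (G : SimpleGraph V) : V → ℝ :=
  Matrix.vecMul (fun _ => 1) (1 - α • rowNormalizedAdj G)⁻¹

theorem pageRank_uniformPreference {V : Type*} [Fintype V] (α : ℝ) (G : SimpleGraph V) (x : V) :
    pageRank α (uniformPreference V) G x
      = (1 - α) / (Fintype.card V : ℝ) * pageRankSeries α G x := by
  classical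
  have h : uniformPreference V = (1 / (Fintype.card V : ℝ)) • (fun _ : V => (1 : ℝ)) := by
    ext; simp [uniformPreference]
  simp only [pageRank, pageRankSeries]
  rw [h, Matrix.smul_vecMul]
  simp only [Pi.smul_apply, smul_eq_mul]
  ring

theorem pageRank_lt_pageRank_iff {V : Type*} [Fintype V] {α : ℝ} (h1 : α < 1)
    (G : SimpleGraph V) (x y : V) :
    pageRank α (uniformPreference V) G x < pageRank α (uniformPreference V) G y
      ↔ pageRankSeries α G x < pageRankSeries α G y := by
  rw [pageRank_uniformPreference, pageRank_uniformPreference]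
  have : 0 < (Fintype.card V : ℝ) := by
    exact_mod_cast Fintype.card_pos_iff.mpr ⟨x⟩
  exact mul_lt_mul_iff_right₀ (div_pos (by linarith) this)

open Classical in
theorem pageRankSeries_eq {V : Type*} [Fintype V] {α : ℝ} (h0 : 0 ≤ α) (h1 : α < 1)
    (G : SimpleGraph V) (x : V) :
    pageRankSeries α G x
      = 1 + α * ∑ y, if G.Adj x y then pageRankSeries α G y / (G.degree y : ℝ) else 0 := by
  have hu := (Matrix.isUnit_iff_isUnit_det _).mp
    (isUnit_one_sub_smul_rowNormalizedAdj h0 h1 G)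
  have h : Matrix.vecMul (pageRankSeries α G) (1 - α • rowNormalizedAdj G) = fun _ => 1 := by
    rw [pageRankSeries, Matrix.vecMul_vecMul, Matrix.nonsing_inv_mul _ hu, Matrix.vecMul_one]
  have hx := congrFun h x
  rw [Matrix.vecMul_sub, Matrix.vecMul_one, Matrix.vecMul_smul] at hx
  have hs : Matrix.vecMul (pageRankSeries α G) (rowNormalizedAdj G) x
      = ∑ y, if G.Adj x y then pageRankSeries α G y / (G.degree y : ℝ) else 0 := by
    simp only [Matrix.vecMul, dotProduct, rowNormalizedAdj, Matrix.of_apply, mul_ite, mul_one_div,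
      mul_zero, G.adj_comm x]
  simp only [Pi.sub_apply, Pi.smul_apply, smul_eq_mul, hs] at hx
  linarith

open Classical in
/-- Divided by the degrees, the series satisfies `q x = 1 / deg x + α * (mean of q over the
neighbours of x)`, so the maximum principle bounds it independently of the graph. -/
theorem abs_pageRankSeries_div_degree_le {V : Type*} [Fintype V] {α : ℝ} (h0 : 0 ≤ α)
    (h1 : α < 1) (G : SimpleGraph V) (x : V) :
    |pageRankSeries α G x / (G.degree x : ℝ)| ≤ 1 / (1 - α) := by
  set q : V → ℝ := fun y => pageRankSeries α G y / (G.degree y : ℝ) with hq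
  obtain ⟨m, -, hm⟩ := Finset.exists_max_image Finset.univ (fun y => |q y|) ⟨x, Finset.mem_univ x⟩
  refine (hm x (Finset.mem_univ x)).trans ?_
  rw [le_div_iff₀ (by linarith)]
  rcases Nat.eq_zero_or_pos (G.degree m) with hd | hd
  -- At an isolated vertex the quotient has the value `0` by convention.
  · simp [hq, hd]
  have hd1 : (1 : ℝ) ≤ G.degree m := by exact_mod_cast hd
  have hsum : |∑ y, if G.Adj m y then q y else 0| ≤ G.degree m * |q m| := by
    calc |∑ y, if G.Adj m y then q y else 0|
        ≤ ∑ y, |if G.Adj m y then q y else 0| := Finset.abs_sum_le_sum_abs _ _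
      _ ≤ ∑ y, if G.Adj m y then |q m| else 0 := by
          refine Finset.sum_le_sum fun y _ => ?_
          split_ifs
          · exact hm y (Finset.mem_univ y)
          · simp
      _ = G.degree m * |q m| := by
          rw [← Finset.sum_filter, Finset.sum_const, ← SimpleGraph.neighborFinset_eq_filter,
            SimpleGraph.card_neighborFinset_eq_degree, nsmul_eq_mul]
  have hs := pageRankSeries_eq h0 h1 G m
  have hqm : |q m| * G.degree m = |pageRankSeries α G m| := by
    rw [hq, abs_div, Nat.abs_cast, div_mul_cancel₀ _ (by positivity)]
  have hle : |pageRankSeries α G m| ≤ 1 + α * (G.degree m * |q m|) := by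
    rw [hs]
    refine (abs_add_le _ _).trans ?_
    rw [abs_one, abs_mul, abs_of_nonneg h0]
    gcongr
  -- Multiplied by the degree, the claim at the maximum `m` only needs `1 ≤ G.degree m`.
  have hmul : (|q m| * (1 - α)) * G.degree m ≤ 1 := by
    nlinarith
  have hnn : 0 ≤ |q m| * (1 - α) := mul_nonneg (abs_nonneg _) (by linarith)
  nlinarith

/-! ### Graphs described by labels -/

/-- Symmetric closure of a finite set of pairs of labels. -/
def LabelAdj {ι : Type*} (E : Finset (ι × ι)) (i j : ι) : Prop := (i, j) ∈ E ∨ (j, i) ∈ E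

instance {ι : Type*} [DecidableEq ι] (E : Finset (ι × ι)) : DecidableRel (LabelAdj E) :=
  fun i j => inferInstanceAs (Decidable ((i, j) ∈ E ∨ (j, i) ∈ E))

/-- The graph with `m i` vertices of label `i`, where distinct vertices are adjacent precisely when
their labels are; a label adjacent to itself gives a clique. -/
def labelGraph {ι : Type*} (m : ι → ℕ) (E : Finset (ι × ι)) : SimpleGraph ((i : ι) × Fin (m i)) :=
  SimpleGraph.fromRel fun x y => (x.1, y.1) ∈ E

/-- The common degree of the vertices of label `i` in `labelGraph m E`. -/
def labelDegree {ι : Type*} [Fintype ι] [DecidableEq ι] (m : ι → ℕ) (E : Finset (ι × ι)) (i : ι) :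
    ℝ :=
  (∑ j, if LabelAdj E i j then (m j : ℝ) else 0) - if LabelAdj E i i then 1 else 0

section LabelGraph

variable {ι : Type*} [Fintype ι] [DecidableEq ι] (m : ι → ℕ) (E : Finset (ι × ι))

open Classical in
theorem sum_labelGraph_adj (f : ((i : ι) × Fin (m i)) → ℝ) (x : (i : ι) × Fin (m i)) :
    (∑ y, if (labelGraph m E).Adj x y then f y else 0)
      = (∑ y, if LabelAdj E x.1 y.1 then f y else 0) - if LabelAdj E x.1 x.1 then f x else 0 := by
  rw [eq_sub_iff_add_eq, ← Finset.sum_erase_add _ _ (Finset.mem_univ x),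
    ← Finset.sum_erase_add _ (fun y => if LabelAdj E x.1 y.1 then f y else 0)
      (Finset.mem_univ x)]
  have h : ∀ y ∈ Finset.univ.erase x, (if (labelGraph m E).Adj x y then f y else 0)
      = if LabelAdj E x.1 y.1 then f y else 0 := by
    intro y hy
    have hne : x ≠ y := (Finset.ne_of_mem_erase hy).symm
    have : (labelGraph m E).Adj x y ↔ LabelAdj E x.1 y.1 := by
      simp [labelGraph, LabelAdj, SimpleGraph.fromRel_adj, hne]
    simp only [this]
  rw [Finset.sum_congr rfl h]
  simp

theorem sum_labelAdj_fst (g : ι → ℝ) (i : ι) :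
    (∑ y : (j : ι) × Fin (m j), if LabelAdj E i y.1 then g y.1 else 0)
      = ∑ j, if LabelAdj E i j then m j * g j else 0 := by
  rw [Fintype.sum_sigma]
  refine Finset.sum_congr rfl fun j _ => ?_
  split_ifs <;> simp

open Classical in
theorem degree_labelGraph (x : (i : ι) × Fin (m i)) :
    ((labelGraph m E).degree x : ℝ) = labelDegree m E x.1 := by
  have h := sum_labelGraph_adj m E (fun _ => 1) x
  rw [sum_labelAdj_fst m E (fun _ => 1)] at h
  rw [← Finset.sum_filter, Finset.sum_const, ← SimpleGraph.neighborFinset_eq_filter,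
    SimpleGraph.card_neighborFinset_eq_degree, nsmul_eq_mul, mul_one] at h
  simpa [labelDegree] using h

/-- Vertices with the same label have the same score, because they have the same neighbours up to
the two vertices themselves. -/
theorem pageRankSeries_labelGraph_congr {α : ℝ} (h0 : 0 ≤ α) (h1 : α < 1)
    (x y : (i : ι) × Fin (m i)) (hxy : x.1 = y.1) :
    pageRankSeries α (labelGraph m E) x = pageRankSeries α (labelGraph m E) y := by
  classical
  have hx := pageRankSeries_eq h0 h1 (labelGraph m E) x
  have hy := pageRankSeries_eq h0 h1 (labelGraph m E) y
  rw [sum_labelGraph_adj, degree_labelGraph] at hx hy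
  rw [hxy] at hx
  have hd : 0 ≤ labelDegree m E y.1 := by
    rw [← degree_labelGraph]; positivity
  split_ifs at hx hy with h
  · have key : (pageRankSeries α (labelGraph m E) x - pageRankSeries α (labelGraph m E) y)
        * (1 + α / labelDegree m E y.1) = 0 := by
      linear_combination hx - hy
    have hpos : 1 + α / labelDegree m E y.1 ≠ 0 := by positivity
    exact sub_eq_zero.mp ((mul_eq_zero.mp key).resolve_right hpos)
  · rw [hx, hy]

/-- PageRank on a labelled graph reduces to a linear system indexed by the labels. -/
theorem exists_labelScore {α : ℝ} (h0 : 0 ≤ α) (h1 : α < 1) (hm : ∀ i, 0 < m i) :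
    ∃ s : ι → ℝ, (∀ x, pageRankSeries α (labelGraph m E) x = s x.1) ∧
      (∀ i, |s i / labelDegree m E i| ≤ 1 / (1 - α)) ∧
      ∀ i, s i = 1 + α * ((∑ j, if LabelAdj E i j then m j * (s j / labelDegree m E j) else 0)
        - if LabelAdj E i i then s i / labelDegree m E i else 0) := by
  classical
  have hs : ∀ x, pageRankSeries α (labelGraph m E) x
      = pageRankSeries α (labelGraph m E) ⟨x.1, ⟨0, hm x.1⟩⟩ := fun x =>
    pageRankSeries_labelGraph_congr m E h0 h1 _ _ rfl
  refine ⟨fun i => pageRankSeries α (labelGraph m E) ⟨i, ⟨0, hm i⟩⟩, hs, fun i => ?_, fun i => ?_⟩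
  · have h := abs_pageRankSeries_div_degree_le h0 h1 (labelGraph m E) ⟨i, ⟨0, hm i⟩⟩
    rwa [degree_labelGraph] at h
  · have h := pageRankSeries_eq h0 h1 (labelGraph m E) ⟨i, ⟨0, hm i⟩⟩
    rw [sum_labelGraph_adj] at h
    simp only [degree_labelGraph] at h
    rw [← sum_labelAdj_fst m E (fun j => pageRankSeries α (labelGraph m E) ⟨j, ⟨0, hm j⟩⟩
      / labelDegree m E j)]
    simpa only [← hs] using h

end LabelGraph

/-! ### The graphs `G_k` and `G_k'` -/

theorem prGraph_eq_labelGraph (k : ℕ) : prGraph k = labelGraph (prMult k) prLabelEdges := rfl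

theorem addEdge_prGraph_eq_labelGraph (k : ℕ) :
    addEdge (prGraph k) (prV0 k) (prV1 k)
      = labelGraph (prMult k) (insert (0, 1) prLabelEdges) := by
  have e0 : ∀ x : PRVertex k, x = prV0 k ↔ x.1 = 0 := by
    rintro ⟨l, i⟩
    refine ⟨fun h => by rw [h]; rfl, fun h => ?_⟩
    dsimp only at h
    subst h
    have : i = ⟨0, Nat.one_pos⟩ := Fin.ext (Nat.lt_one_iff.mp i.2)
    rw [this]; rfl
  have e1 : ∀ x : PRVertex k, x = prV1 k ↔ x.1 = 1 := by
    rintro ⟨l, i⟩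
    refine ⟨fun h => by rw [h]; rfl, fun h => ?_⟩
    dsimp only at h
    subst h
    have : i = ⟨0, Nat.one_pos⟩ := Fin.ext (Nat.lt_one_iff.mp i.2)
    rw [this]; rfl
  ext x y
  simp only [addEdge, prGraph, labelGraph, SimpleGraph.sup_adj, SimpleGraph.fromRel_adj,
    SimpleGraph.edge_adj, Finset.mem_insert, Prod.mk.injEq, e0, e1]
  tauto

/-- The system of `exists_labelScore`, written out for `G_k` (`e = 0`) and for `G_k'` (`e = 1`).
The vertex `0` has degree `k + e` and the vertex `1` has degree `1 + e`; the fields `bound` concern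
the quotients of score and degree. -/
structure IsPRScore (α e : ℝ) (k : ℕ) (s : Fin 9 → ℝ) : Prop where
  eq0 : s 0 = 1 + α * (e * (s 1 / (1 + e)) + s 7 / (k + 1) + (k - 1) * (s 8 / k))
  eq1 : s 1 = 1 + α * (s 2 / 2 + e * (s 0 / (k + e)))
  eq2 : s 2 = 1 + α * (s 1 / (1 + e) + s 3 / (k + 2))
  eq3 : s 3 = 1 + α * (s 2 / 2 + k * (s 4 / k) + s 5 / 2)
  eq4 : s 4 = 1 + α * (s 3 / (k + 2) + (k - 1) * (s 4 / k))
  eq5 : s 5 = 1 + α * (s 3 / (k + 2) + s 6 / 2)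
  eq6 : s 6 = 1 + α * (s 5 / 2 + s 7 / (k + 1))
  eq7 : s 7 = 1 + α * (s 0 / (k + e) + s 6 / 2 + (k - 1) * (s 8 / k))
  eq8 : s 8 = 1 + α * (s 0 / (k + e) + s 7 / (k + 1) + (k - 2) * (s 8 / k))
  bound0 : |s 0 / (k + e)| ≤ 1 / (1 - α)
  bound1 : |s 1 / (1 + e)| ≤ 1 / (1 - α)
  bound2 : |s 2 / 2| ≤ 1 / (1 - α)
  bound3 : |s 3 / (k + 2)| ≤ 1 / (1 - α)
  bound5 : |s 5 / 2| ≤ 1 / (1 - α)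
  bound6 : |s 6 / 2| ≤ 1 / (1 - α)
  bound7 : |s 7 / (k + 1)| ≤ 1 / (1 - α)

theorem prMult_pos {k : ℕ} (hk : 2 ≤ k) (l : Fin 9) : 0 < prMult k l := by
  fin_cases l <;> simp [prMult] <;> omega

theorem exists_isPRScore_prGraph {α : ℝ} (h0 : 0 ≤ α) (h1 : α < 1) {k : ℕ} (hk : 2 ≤ k) :
    ∃ s, IsPRScore α 0 k s ∧
      ∀ x, pageRankSeries α (prGraph k) x = s x.1 := by
  rw [prGraph_eq_labelGraph]
  obtain ⟨s, hs, hb, he⟩ :=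
    exists_labelScore (prMult k) prLabelEdges h0 h1 (prMult_pos hk)
  refine ⟨s, ?_, hs⟩
  have hk1 : ((k - 1 : ℕ) : ℝ) = k - 1 := by rw [Nat.cast_sub (by omega)]; simp
  -- The degrees of the vertices `0`, …, `8`.
  have d : labelDegree (prMult k) prLabelEdges
      = ![(k : ℝ), 1, 2, k + 2, k, 2, 2, k + 1, k] := by
    funext l
    fin_cases l <;>
      simp [labelDegree, LabelAdj, prLabelEdges, prMult, Fin.sum_univ_succ, hk1] <;> ring
  rw [d] at hb he
  have e0 := he 0
  have e1 := he 1
  have e2 := he 2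
  have e3 := he 3
  have e4 := he 4
  have e5 := he 5
  have e6 := he 6
  have e7 := he 7
  have e8 := he 8
  -- Evaluate the sums over the nine labels.
  simp only [LabelAdj, prLabelEdges, prMult, Fin.sum_univ_succ] at e0 e1 e2 e3 e4 e5 e6 e7 e8
  simp [hk1] at e0 e1 e2 e3 e4 e5 e6 e7 e8
  constructor
  · simp; linear_combination e0
  · simp; linear_combination e1
  · simp; linear_combination e2
  · linear_combination e3
  · linear_combination e4
  · linear_combination e5
  · linear_combination e6
  · simp; linear_combination e7
  · simp; linear_combination e8
  · simpa using hb 0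
  · simpa [one_add_one_eq_two] using hb 1
  · simpa using hb 2
  · simpa using hb 3
  · simpa using hb 5
  · simpa using hb 6
  · simpa using hb 7

theorem exists_isPRScore_addEdge_prGraph {α : ℝ} (h0 : 0 ≤ α) (h1 : α < 1) {k : ℕ} (hk : 2 ≤ k) :
    ∃ s, IsPRScore α 1 k s ∧
      ∀ x, pageRankSeries α (addEdge (prGraph k) (prV0 k) (prV1 k)) x = s x.1 := by
  rw [addEdge_prGraph_eq_labelGraph]
  obtain ⟨s, hs, hb, he⟩ :=
    exists_labelScore (prMult k) (insert (0, 1) prLabelEdges) h0 h1 (prMult_pos hk)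
  refine ⟨s, ?_, hs⟩
  have hk1 : ((k - 1 : ℕ) : ℝ) = k - 1 := by rw [Nat.cast_sub (by omega)]; simp
  -- The degrees of the vertices `0`, …, `8`.
  have d : labelDegree (prMult k) (insert (0, 1) prLabelEdges)
      = ![(k : ℝ) + 1, 2, 2, k + 2, k, 2, 2, k + 1, k] := by
    funext l
    fin_cases l <;>
      simp [labelDegree, LabelAdj, prLabelEdges, prMult, Fin.sum_univ_succ, hk1] <;> ring
  rw [d] at hb he
  have e0 := he 0
  have e1 := he 1
  have e2 := he 2
  have e3 := he 3
  have e4 := he 4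
  have e5 := he 5
  have e6 := he 6
  have e7 := he 7
  have e8 := he 8
  -- Evaluate the sums over the nine labels.
  simp only [LabelAdj, prLabelEdges, prMult, Fin.sum_univ_succ] at e0 e1 e2 e3 e4 e5 e6 e7 e8
  simp [hk1] at e0 e1 e2 e3 e4 e5 e6 e7 e8
  constructor
  · simp; linear_combination e0
  · simp; linear_combination e1
  · linear_combination e2
  · linear_combination e3
  · linear_combination e4
  · linear_combination e5
  · linear_combination e6
  · linear_combination e7
  · linear_combination e8
  · simpa using hb 0
  · simpa [one_add_one_eq_two] using hb 1
  · simpa using hb 2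
  · simpa using hb 3
  · simpa using hb 5
  · simpa using hb 6
  · simpa using hb 7

/-! ### Asymptotics of the scores -/

open Filter Topology

/-- Bound for the score `x` of a clique vertex, which gets `w * x` from the vertices of the clique
with its own label and `u` from its other neighbours. -/
theorem abs_le_of_eq_one_add_mul {α u w x U : ℝ} (h0 : 0 ≤ α) (h1 : α < 1) (hu : |u| ≤ U)
    (hw0 : 0 ≤ w) (hw1 : w ≤ 1) (hx : x = 1 + α * (u + w * x)) : |x| ≤ (1 + U) / (1 - α) := by
  rw [le_div_iff₀ (by linarith)]
  have h : |x| ≤ 1 + α * (U + |x|) := by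
    calc |x| = |1 + α * (u + w * x)| := by rw [← hx]
      _ ≤ 1 + α * (|u| + w * |x|) := by
          refine (abs_add_le _ _).trans ?_
          rw [abs_one, abs_mul, abs_of_nonneg h0]
          gcongr
          refine (abs_add_le _ _).trans ?_
          rw [abs_mul, abs_of_nonneg hw0]
      _ ≤ 1 + α * (U + |x|) := by
          gcongr
          exact mul_le_of_le_one_left (abs_nonneg x) hw1
  have hU : 0 ≤ U := (abs_nonneg u).trans hu
  nlinarith

/-- The scores of the vertices `0`, `3`, `7` are bounded uniformly in `k`, although their degrees
are not. -/
theorem IsPRScore.abs_le {α e : ℝ} {k : ℕ} {s : Fin 9 → ℝ} (hs : IsPRScore α e k s) (h0 : 0 ≤ α)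
    (h1 : α < 1) (he0 : 0 ≤ e) (he1 : e ≤ 1) (hk : 2 ≤ k) :
    ∀ i ∈ ({0, 3, 7} : Set (Fin 9)),
      |s i| ≤ 1 + 2 * (1 / (1 - α)) + (1 + 2 * (1 / (1 - α))) / (1 - α) := by
  have hk2 : (2 : ℝ) ≤ k := by exact_mod_cast hk
  have hkpos : (0 : ℝ) < k := by linarith
  set B := 1 / (1 - α) with hB
  set T := (1 + 2 * B) / (1 - α) with hT
  have hBpos : 0 < B := one_div_pos.mpr (by linarith)
  have hw : (k - 1 : ℝ) / k ∈ Set.Icc (0 : ℝ) 1 :=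
    ⟨div_nonneg (by linarith) (by linarith), (div_le_one hkpos).mpr (by linarith)⟩
  have hw' : (k - 2 : ℝ) / k ∈ Set.Icc (0 : ℝ) 1 :=
    ⟨div_nonneg (by linarith) (by linarith), (div_le_one hkpos).mpr (by linarith)⟩
  have b4 : |s 4| ≤ T := by
    refine abs_le_of_eq_one_add_mul (u := s 3 / (k + 2)) (w := (k - 1) / k) h0 h1 ?_ hw.1 hw.2 ?_
    · linarith [hs.bound3]
    · have := hs.eq4
      rw [mul_div_left_comm, mul_comm (s 4)] at this
      exact this
  have b8 : |s 8| ≤ T := by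
    refine abs_le_of_eq_one_add_mul (u := s 0 / (k + e) + s 7 / (k + 1)) (w := (k - 2) / k)
      h0 h1 ?_ hw'.1 hw'.2 ?_
    · linarith [hs.bound0, hs.bound7, abs_add_le (s 0 / (k + e)) (s 7 / (k + 1))]
    · have := hs.eq8
      rw [mul_div_left_comm, mul_comm (s 8)] at this
      exact this
  have b8' : |(k - 1) * (s 8 / k)| ≤ T := by
    rw [mul_div_left_comm, abs_mul, abs_of_nonneg hw.1]
    exact (mul_le_of_le_one_right (abs_nonneg _) hw.2).trans b8
  have main : ∀ a b c : ℝ, |a| ≤ B → |b| ≤ B → |c| ≤ T → |1 + α * (a + b + c)| ≤ 1 + 2 * B + T := by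
    intro a b c ha hb hc
    refine (abs_add_le _ _).trans ?_
    rw [abs_one, abs_mul, abs_of_nonneg h0]
    have : α * |a + b + c| ≤ |a + b + c| := mul_le_of_le_one_left (abs_nonneg _) h1.le
    linarith [abs_add_three a b c]
  rintro i (rfl | rfl | rfl)
  · rw [hs.eq0]
    refine main _ _ _ ?_ hs.bound7 b8'
    rw [abs_mul, abs_of_nonneg he0]
    exact (mul_le_of_le_one_left (abs_nonneg _) he1).trans hs.bound1
  · rw [hs.eq3, mul_div_cancel₀ _ hkpos.ne', add_right_comm]
    exact main _ _ _ hs.bound2 hs.bound5 b4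
  · rw [hs.eq7]
    exact main _ _ _ hs.bound0 hs.bound6 b8'

theorem tendsto_div_natCast_add_atTop {x : ℕ → ℝ} {C c : ℝ} (hc : 0 ≤ c)
    (hx : ∀ k, 2 ≤ k → |x k| ≤ C) : Tendsto (fun k : ℕ => x k / (k + c)) atTop (𝓝 0) := by
  refine squeeze_zero_norm' (a := fun k : ℕ => C / k) ?_
    (tendsto_const_div_atTop_nhds_zero_nat C)
  filter_upwards [eventually_ge_atTop 2] with k hk
  have hk2 : (2 : ℝ) ≤ k := by exact_mod_cast hk
  rw [Real.norm_eq_abs, abs_div, abs_of_pos (show (0 : ℝ) < k + c by linarith)]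
  exact div_le_div₀ ((abs_nonneg _).trans (hx k hk)) (hx k hk) (by linarith) (by linarith)

theorem tendsto_sub_div_natCast (c : ℝ) :
    Tendsto (fun k : ℕ => ((k : ℝ) - c) / k) atTop (𝓝 1) := by
  have h := (tendsto_const_div_atTop_nhds_zero_nat c).const_sub 1
  rw [sub_zero] at h
  refine h.congr' ?_
  filter_upwards [eventually_ge_atTop 1] with k hk
  have : (k : ℝ) ≠ 0 := by positivity
  field_simp

/-- The score of a vertex inside a large clique tends to `1 / (1 - α)`. -/
theorem tendsto_of_eq_one_add_mul {α : ℝ} (h1 : α < 1) {x u w : ℕ → ℝ}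
    (hu : Tendsto u atTop (𝓝 0)) (hw : Tendsto w atTop (𝓝 1))
    (hx : ∀ k, 2 ≤ k → x k = 1 + α * (u k + w k * x k)) :
    Tendsto x atTop (𝓝 (1 / (1 - α))) := by
  have hd : Tendsto (fun k => 1 - α * w k) atTop (𝓝 (1 - α)) := by
    simpa using (hw.const_mul α).const_sub 1
  have hn : Tendsto (fun k => 1 + α * u k) atTop (𝓝 1) := by
    simpa using (hu.const_mul α).const_add 1
  refine (hn.div hd (by linarith)).congr' ?_
  filter_upwards [eventually_ge_atTop 2, hd.eventually_const_lt (u := 0) (by linarith)] with k hk hp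
  rw [Pi.div_apply, div_eq_iff hp.ne']
  linear_combination -hx k hk

/-- The scores of two adjacent vertices of degree two whose other neighbours have large degree
tend to `1 / (1 - α / 2)`. -/
theorem tendsto_of_pair {α : ℝ} (h0 : 0 ≤ α) (h1 : α < 1) {x y u v : ℕ → ℝ}
    (hu : Tendsto u atTop (𝓝 0)) (hv : Tendsto v atTop (𝓝 0))
    (hx : ∀ k, 2 ≤ k → x k = 1 + α * (y k / 2 + u k))
    (hy : ∀ k, 2 ≤ k → y k = 1 + α * (x k / 2 + v k)) :
    Tendsto x atTop (𝓝 (1 / (1 - α / 2))) := by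
  have hd : 1 - α ^ 2 / 4 ≠ 0 := by nlinarith
  have hd' : 1 - α / 2 ≠ 0 := by linarith
  have h := (((hu.const_mul α).const_add (1 + α / 2)).add (hv.const_mul (α ^ 2 / 2))).div_const
    (1 - α ^ 2 / 4)
  have e : (1 + α / 2 + α * 0 + α ^ 2 / 2 * 0) / (1 - α ^ 2 / 4) = 1 / (1 - α / 2) := by
    rw [div_eq_div_iff hd hd']; ring
  rw [e] at h
  refine h.congr' ?_
  filter_upwards [eventually_ge_atTop 2] with k hk
  rw [div_eq_iff hd]
  linear_combination -hx k hk - α / 2 * hy k hk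

/-- The limits common to `G_k` (`e = 0`) and `G_k'` (`e = 1`); `quot0`, `quot3`, `quot7` are what
the vertices `0`, `3`, `7` pass on to each of their neighbours. -/
structure PRLimits (α e : ℝ) (s : ℕ → Fin 9 → ℝ) : Prop where
  quot0 : Tendsto (fun k => s k 0 / (k + e)) atTop (𝓝 0)
  quot3 : Tendsto (fun k => s k 3 / (k + 2)) atTop (𝓝 0)
  quot7 : Tendsto (fun k => s k 7 / (k + 1)) atTop (𝓝 0)
  lim4 : Tendsto (fun k => s k 4) atTop (𝓝 (1 / (1 - α)))
  lim5 : Tendsto (fun k => s k 5) atTop (𝓝 (1 / (1 - α / 2)))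
  lim6 : Tendsto (fun k => s k 6) atTop (𝓝 (1 / (1 - α / 2)))
  lim8 : Tendsto (fun k => s k 8) atTop (𝓝 (1 / (1 - α)))
  lim8' : Tendsto (fun k : ℕ => (k - 1) * (s k 8 / k)) atTop (𝓝 (1 / (1 - α)))

theorem PRLimits.of_isPRScore {α e : ℝ} (h0 : 0 ≤ α) (h1 : α < 1) (he0 : 0 ≤ e) (he1 : e ≤ 1)
    {s : ℕ → Fin 9 → ℝ} (hs : ∀ k, 2 ≤ k → IsPRScore α e k (s k)) : PRLimits α e s := by
  have q0 := tendsto_div_natCast_add_atTop he0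
    fun k hk => (hs k hk).abs_le h0 h1 he0 he1 hk 0 (by simp)
  have q3 := tendsto_div_natCast_add_atTop zero_le_two
    fun k hk => (hs k hk).abs_le h0 h1 he0 he1 hk 3 (by simp)
  have q7 := tendsto_div_natCast_add_atTop zero_le_one
    fun k hk => (hs k hk).abs_le h0 h1 he0 he1 hk 7 (by simp)
  have l8 : Tendsto (fun k => s k 8) atTop (𝓝 (1 / (1 - α))) := by
    refine tendsto_of_eq_one_add_mul h1 (by simpa using q0.add q7) (tendsto_sub_div_natCast 2) ?_
    intro k hk
    have := (hs k hk).eq8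
    rwa [mul_div_left_comm, mul_comm (s k 8)] at this
  refine ⟨q0, q3, q7, ?_, ?_, ?_, l8, ?_⟩
  · refine tendsto_of_eq_one_add_mul h1 q3 (tendsto_sub_div_natCast 1) ?_
    intro k hk
    have := (hs k hk).eq4
    rwa [mul_div_left_comm, mul_comm (s k 4)] at this
  · exact tendsto_of_pair h0 h1 q3 q7 (y := fun k => s k 6)
      (fun k hk => by linear_combination (hs k hk).eq5) (fun k hk => (hs k hk).eq6)
  · exact tendsto_of_pair h0 h1 q7 q3 (y := fun k => s k 5)
      (fun k hk => (hs k hk).eq6) (fun k hk => by linear_combination (hs k hk).eq5)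
  · have h := (tendsto_sub_div_natCast 1).mul l8
    rw [one_mul] at h
    exact h.congr fun k => by ring

theorem eventually_prGraph_lt {α : ℝ} (h0 : 0 < α) (h1 : α < 1) {s : ℕ → Fin 9 → ℝ}
    (hs : ∀ k, 2 ≤ k → IsPRScore α 0 k (s k)) :
    ∀ᶠ k in atTop, s k 1 < s k 0 ∧ s k 5 < s k 1 ∧ s k 6 < s k 1 := by
  have hl := PRLimits.of_isPRScore h0.le h1 le_rfl zero_le_one hs
  have hα1 : 0 < 1 - α := by linarith
  have hα2 : 0 < 1 - α ^ 2 / 2 := by nlinarith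
  have hα3 : 0 < 1 - α / 2 := by linarith
  have l1 : Tendsto (fun k => s k 1) atTop (𝓝 ((1 + α / 2) / (1 - α ^ 2 / 2))) := by
    have h := ((hl.quot3.const_mul (α ^ 2 / 2)).const_add (1 + α / 2)).div_const (1 - α ^ 2 / 2)
    rw [mul_zero, add_zero] at h
    refine h.congr' ?_
    filter_upwards [eventually_ge_atTop 2] with k hk
    have e1 := (hs k hk).eq1
    have e2 := (hs k hk).eq2
    simp only [zero_mul, add_zero, div_one] at e1 e2
    rw [div_eq_iff hα2.ne']
    linear_combination -e1 - α / 2 * e2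
  have l0 : Tendsto (fun k => s k 0) atTop (𝓝 (1 + α * (0 + 1 / (1 - α)))) := by
    refine (((hl.quot7.add hl.lim8').const_mul α).const_add 1).congr' ?_
    filter_upwards [eventually_ge_atTop 2] with k hk
    linear_combination -(hs k hk).eq0
  have c1 : (1 + α / 2) / (1 - α ^ 2 / 2) < 1 + α * (0 + 1 / (1 - α)) := by
    have : 1 + α * (0 + 1 / (1 - α)) = 1 / (1 - α) := by field_simp; ring
    rw [this, div_lt_div_iff₀ hα2 hα1]
    nlinarith
  have c2 : 1 / (1 - α / 2) < (1 + α / 2) / (1 - α ^ 2 / 2) := by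
    rw [div_lt_div_iff₀ hα3 hα2]
    nlinarith
  filter_upwards [l1.eventually_lt l0 c1, hl.lim5.eventually_lt l1 c2,
    hl.lim6.eventually_lt l1 c2] with k a b c
  exact ⟨a, b, c⟩

/-- In `G_k'` the scores of `1`, `2`, `5` have the same limit, so that they have to be compared at
order `1 / k`. -/
theorem eventually_addEdge_prGraph_lt {α : ℝ} (h0 : 0 < α) (h1 : α < 1) {s : ℕ → Fin 9 → ℝ}
    (hs : ∀ k, 2 ≤ k → IsPRScore α 1 k (s k)) :
    ∀ᶠ k in atTop, ∀ i : Fin 9, i ≠ 1 → i ≠ 6 → s k 1 < s k i := by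
  have hl := PRLimits.of_isPRScore h0.le h1 zero_le_one le_rfl hs
  have hα1 : 0 < 1 - α := by linarith
  have hα3 : 0 < 1 - α / 2 := by linarith
  have e1 : ∀ k, 2 ≤ k → s k 1 = 1 + α * (s k 2 / 2 + s k 0 / (k + 1)) := fun k hk => by
    simpa using (hs k hk).eq1
  have e2 : ∀ k, 2 ≤ k → s k 2 = 1 + α * (s k 1 / 2 + s k 3 / (k + 2)) := fun k hk => by
    simpa [one_add_one_eq_two] using (hs k hk).eq2
  have l1 := tendsto_of_pair h0.le h1 hl.quot0 hl.quot3 e1 e2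
  have l2 := tendsto_of_pair h0.le h1 hl.quot3 hl.quot0 e2 e1
  set r := 1 / (1 - α / 2) with hr
  set L := 1 / (1 - α) with hL
  have hr0 : 0 < r := one_div_pos.mpr hα3
  have hrL : r < L := one_div_lt_one_div_of_lt hα1 (by linarith)
  have hLeq : 1 + α * L = L := by rw [hL]; field_simp; ring
  have l0 : Tendsto (fun k => s k 0) atTop (𝓝 (1 + α * (r / 2 + 0 + L))) := by
    refine (((((l1.div_const 2).add hl.quot7).add hl.lim8').const_mul α).const_add 1).congr' ?_
    filter_upwards [eventually_ge_atTop 2] with k hk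
    have := (hs k hk).eq0
    norm_num at this
    linear_combination -this
  have l7 : Tendsto (fun k => s k 7) atTop (𝓝 (1 + α * (0 + r / 2 + L))) := by
    refine ((((hl.quot0.add (hl.lim6.div_const 2)).add hl.lim8').const_mul α).const_add 1).congr' ?_
    filter_upwards [eventually_ge_atTop 2] with k hk
    exact (hs k hk).eq7.symm
  have l3 : Tendsto (fun k => s k 3) atTop (𝓝 (1 + α * (r / 2 + L + r / 2))) := by
    refine (((((l2.div_const 2).add hl.lim4).add (hl.lim5.div_const 2)).const_mul
      α).const_add 1).congr' ?_
    filter_upwards [eventually_ge_atTop 2] with k hk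
    have := (hs k hk).eq3
    rw [mul_div_cancel₀ _ (by positivity)] at this
    exact this.symm
  -- This is `k + 1` times the quotient of score and degree of `3`; likewise `s k 0` and `s k 7` are
  -- `k + 1` times the quotients of `0` and `7`.
  have l3' : Tendsto (fun k : ℕ => s k 3 - s k 3 / (k + 2)) atTop
      (𝓝 (1 + α * (r / 2 + L + r / 2) - 0)) := l3.sub hl.quot3
  have hαr : 0 < α * r := mul_pos h0 hr0
  have c32 := l0.eventually_lt l3' (by linarith)
  -- The two limits are `α * r / 2` and `-α * r / 2`, weighted by `α` and `α ^ 2 / 2`.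
  have c35 := (tendsto_const_nhds (x := (0 : ℝ))).eventually_lt
    (((l3'.sub l0).const_mul α).add ((l7.sub l3').const_mul (α ^ 2 / 2))) (by
      have : 0 < (α * r) * α * (1 - α / 2) := mul_pos (mul_pos hαr h0) hα3
      nlinarith)
  filter_upwards [eventually_ge_atTop 2, c32, c35, l1.eventually_lt l0 (by linarith),
    l1.eventually_lt l3 (by linarith), l1.eventually_lt l7 (by linarith),
    l1.eventually_lt hl.lim4 hrL, l1.eventually_lt hl.lim8 hrL] with k hk c32 c35 a0 a3 a7 a4 a8
  have hk0 : (0 : ℝ) < k + 1 := by positivity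
  have hq0 : s k 0 = (k + 1) * (s k 0 / (k + 1)) := by field_simp
  have hq7 : s k 7 = (k + 1) * (s k 7 / (k + 1)) := by field_simp
  have hq3 : s k 3 - s k 3 / (k + 2) = (k + 1) * (s k 3 / (k + 2)) := by
    have : (k + 2 : ℝ) ≠ 0 := by positivity
    field_simp; ring
  rw [hq3, hq0] at c32
  rw [hq3, hq0, hq7] at c35
  have c32' : 0 < s k 3 / (k + 2) - s k 0 / (k + 1) :=
    sub_pos.mpr (lt_of_mul_lt_mul_left c32 hk0.le)
  have c35' : 0 < α * (s k 3 / (k + 2) - s k 0 / (k + 1))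
      + α ^ 2 / 2 * (s k 7 / (k + 1) - s k 3 / (k + 2)) := by
    refine pos_of_mul_pos_right (a := (k + 1 : ℝ)) ?_ hk0.le
    linarith
  have a2 : s k 1 < s k 2 := by
    have : (s k 2 - s k 1) * (1 + α / 2) = α * (s k 3 / (k + 2) - s k 0 / (k + 1)) := by
      linear_combination e2 k hk - e1 k hk
    have hp : 0 < (s k 2 - s k 1) * (1 + α / 2) := this ▸ mul_pos h0 c32'
    exact sub_pos.mp (pos_of_mul_pos_left hp (by positivity))
  have a5 : s k 1 < s k 5 := by
    have : (s k 5 - s k 1) * (1 - α ^ 2 / 4) = α * (s k 3 / (k + 2) - s k 0 / (k + 1))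
        + α ^ 2 / 2 * (s k 7 / (k + 1) - s k 3 / (k + 2)) := by
      linear_combination (hs k hk).eq5 - e1 k hk + α / 2 * (hs k hk).eq6 - α / 2 * e2 k hk
    have hp := this ▸ c35'
    exact sub_pos.mp (pos_of_mul_pos_left hp (by nlinarith))
  intro i hi1 hi6
  fin_cases i <;> first | assumption | contradiction

/-! ### The violation of rank monotonicity -/

theorem not_isRankMonotoneOn_prGraph {k : ℕ} {c : Centrality (PRVertex k)}
    (hadj : ¬ (prGraph k).Adj (prV0 k) (prV1 k))
    (h : c (prGraph k) (prV5 k) < c (prGraph k) (prV1 k))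
    (h' : c (addEdge (prGraph k) (prV0 k) (prV1 k)) (prV1 k)
      < c (addEdge (prGraph k) (prV0 k) (prV1 k)) (prV5 k)) :
    ¬ IsRankMonotoneOn c (prGraph k) := fun hm =>
  lt_asymm h' ((hm (prV0 k) (prV1 k) (by simp [prV0, prV1]) hadj (prV5 k) (by simp [prV5, prV0])
    (by simp [prV5, prV1])).2.1 h)

/-- The conjuncts after the failure of rank monotonicity say that it is caused by the new edge
`0 — 1`, at its endpoint `1`, which is less important than `0` (bottom violation), is overtaken by
`5`, and is demoted. -/
theorem mainTheorem7 (α : ℝ) (hα : α ∈ Set.Ioo (0 : ℝ) 1) :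
    ∃ k₀ : ℕ, 1 ≤ k₀ ∧ ∀ k : ℕ, k₀ ≤ k →
      let c : Centrality (PRVertex k) := pageRank α (uniformPreference (PRVertex k))
      let G : SimpleGraph (PRVertex k) := prGraph k
      let G' : SimpleGraph (PRVertex k) := addEdge G (prV0 k) (prV1 k)
      ¬ IsRankMonotoneOn c G ∧
      ¬ G.Adj (prV0 k) (prV1 k) ∧
      c G (prV1 k) < c G (prV0 k) ∧
      c G (prV5 k) < c G (prV1 k) ∧
      c G' (prV1 k) < c G' (prV5 k) ∧
      IsDemoted c G G' (prV1 k) := by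
  obtain ⟨h0, h1⟩ := hα
  have hG : ∀ k, ∃ s, 2 ≤ k → IsPRScore α 0 k s ∧
      ∀ x, pageRankSeries α (prGraph k) x = s x.1 := fun k => by
    by_cases hk : 2 ≤ k
    · exact (exists_isPRScore_prGraph h0.le h1 hk).imp fun _ h _ => h
    · exact ⟨0, fun h => absurd h hk⟩
  have hG' : ∀ k, ∃ s, 2 ≤ k → IsPRScore α 1 k s ∧
      ∀ x, pageRankSeries α (addEdge (prGraph k) (prV0 k) (prV1 k)) x = s x.1 := fun k => by
    by_cases hk : 2 ≤ k
    · exact (exists_isPRScore_addEdge_prGraph h0.le h1 hk).imp fun _ h _ => h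
    · exact ⟨0, fun h => absurd h hk⟩
  choose s hs using hG
  choose s' hs' using hG'
  obtain ⟨N, hN⟩ := eventually_atTop.mp
    ((eventually_prGraph_lt h0 h1 fun k hk => (hs k hk).1).and
      (eventually_addEdge_prGraph_lt h0 h1 fun k hk => (hs' k hk).1))
  refine ⟨max N 2, le_max_of_le_right one_le_two, fun k hk => ?_⟩
  obtain ⟨⟨a10, a51, a61⟩, a'⟩ := hN k (le_of_max_le_left hk)
  have hk2 : 2 ≤ k := le_of_max_le_right hk
  intro c G G'
  have hc : ∀ x y, c G x < c G y ↔ s k x.1 < s k y.1 := fun x y => by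
    rw [← (hs k hk2).2, ← (hs k hk2).2]
    exact pageRank_lt_pageRank_iff h1 _ x y
  have hc' : ∀ x y, c G' x < c G' y ↔ s' k x.1 < s' k y.1 := fun x y => by
    rw [← (hs' k hk2).2, ← (hs' k hk2).2]
    exact pageRank_lt_pageRank_iff h1 _ x y
  have hadj : ¬ G.Adj (prV0 k) (prV1 k) := by
    simp [G, prGraph, SimpleGraph.fromRel_adj, prLabelEdges, prV0, prV1]
  have h5 : c G (prV5 k) < c G (prV1 k) := (hc _ _).mpr a51
  have h5' : c G' (prV1 k) < c G' (prV5 k) := (hc' _ _).mpr (a' 5 (by decide) (by decide))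
  refine ⟨not_isRankMonotoneOn_prGraph hadj h5 h5', hadj, (hc _ _).mpr a10, h5, h5', ?_⟩
  -- Every vertex above `1` in `G_k` stays above it, and `5` is a new one.
  refine Set.ncard_lt_ncard ⟨fun z hz => ?_, fun hsub => ?_⟩ (Set.toFinite _)
  · have hz : s k 1 < s k z.1 := (hc _ _).mp hz
    refine (hc' _ _).mpr (a' z.1 (fun h => ?_) fun h => ?_)
    · rw [h] at hz
      exact lt_irrefl _ hz
    · rw [h] at hz
      exact lt_asymm hz a61
  · exact lt_asymm h5 (hsub h5')
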